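/- Let $\{e_1,e_2,e_3\}$ be the standard basis of $(\mathbb Z_2)^3$. For a simple convex 3-polytope $P$ with a $(\mathbb Z_2)^3$-coloring $\lambda$ (a map from the set of facets to $(\mathbb Z_2)^3$ such that the colors of the three facets meeting at each vertex are linearly independent), let $M(P,\lambda)=P\times(\mathbb Z_2)^3/\!\sim$, where $(x,g)\sim(y,h)$ iff $x=y$ and $g-h$ lies in the subgroup generated by the colors of the facets containing $x$; the group $(\mathbb Z_2)^3$ acts on $M(P,\lambda)$ by translation of the second factor. Let $\Delta^3$ be the 3-simplex with coloring $\lambda_0$ given by $e_1+e_2+e_3,\,e_1,\,e_2,\,e_3$ on its four facets. Let $P^3(3)=\Delta^1\times\Delta^2$ be the 3-sided prism; let $\lambda_1,\lambda_2,\lambda_3,\lambda_4$ be its colorings with the colors $e_2+e_3,\,e_2,\,e_3$ on the three square facets, $e_1$ on one triangular facet, and $e_1$, $e_1+e_2$, $e_1+e_3$, $e_1+e_2+e_3$ respectively on the other triangular facet. Regard $S^1$ as the unit circle in $\mathbb C$ (or in $\mathbb R^2$), and $\mathbb RP^2$ as the space of real lines in $\mathbb R^3$ or in $\mathbb C\oplus\mathbb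 R$. Let $\phi_1$ be the product linear action $$(g_1,g_2,g_3)\cdot\big((x_0,x_1),[y_0,y_1,y_2]\big)=\big((x_0,(-1)^{g_1}x_1),[y_0,(-1)^{g_2}y_1,(-1)^{g_3}y_2]\big)$$ on $S^1\times\mathbb RP^2$, and let $\phi_2,\phi_3,\phi_4$ be the actions on $S^1\times\mathbb RP^2$ in which $e_1,e_2,e_3$ act by the following commuting involutions $t_1,t_2,t_3$: - $\phi_2$: $t_1(z,[v,w])=(\bar z,[zv,w])$, $t_2(z,[v,w])=(z,[-\bar z\bar v,w])$, $t_3(z,[v,w])=(\bar z,[-zv,w])$; - $\phi_3$: $t_1(z,[v,w])=(\bar z,[zv,w])$, $t_2(z,[v,w])=(z,[\bar z\bar v,w])$, $t_3(z,[v,w])=(\bar z,[-zv,w])$; - $\phi_4$: $t_1(z,[v,w])=(\bar z,[\bar zv,w])$, $t_2(z,[v,w])=(z,[z\bar v,w])$, $t_3(z,[v,w])=(z,[-z\bar v,w])$. For $\sigma\in\mathrm{GL}(3,\mathbb Z_2)$, a homeomorphism $f$ is $\sigma$-equivariant if $f(g\cdot x)=\sigma(g)\cdot f(x)$ for all $g$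 and $x$. Let $\sigma_2$ be given by $e_1\mapsto e_1,\ e_2\mapsto e_1+e_3,\ e_3\mapsto e_2$, and $\sigma_3$ by $e_1\mapsto e_1,\ e_2\mapsto e_2,\ e_3\mapsto e_1+e_3$. Then: 1. $M(\Delta^3,\lambda_0)$ is equivariantly homeomorphic to $\mathbb RP^3$ with the canonical linear action $(g_1,g_2,g_3)\cdot[x_0,x_1,x_2,x_3]=[x_0,(-1)^{g_1}x_1,(-1)^{g_2}x_2,(-1)^{g_3}x_3]$. 2. $M(P^3(3),\lambda_1)$ is equivariantly homeomorphic to $(S^1\times\mathbb RP^2,\phi_1)$. 3. For $i=2,3$, $M(P^3(3),\lambda_i)$ is $\sigma_i$-equivariantly homeomorphic to $(S^1\times\mathbb RP^2,\phi_i)$; equivalently, $M(P^3(3),\sigma_i\circ\lambda_i)$ is equivariantly homeomorphic to $(S^1\times\mathbb RP^2,\phi_i)$. 4. $M(P^3(3),\lambda_4)$ is equivariantly homeomorphic to $(S^1\times\mathbb RP^2,\phi_4)$. -/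

import Mathlib

open scoped LinearAlgebra.Projectivization

noncomputable section

/-! ## Colored polytopes and the reconstructed small cover -/

/-- The group `(ℤ/2)^n`, written additively. -/
abbrev TwoTorus (n : ℕ) : Type := Fin n → ZMod 2

/-- A `(ℤ/2)^n`-coloring of a (simple) polytope `P` with family of facets `F`: the colors of the
facets through any point are linearly independent. (It is equivalent to ask this at the vertices,
since the facets through a point of a polytope all pass through some vertex.) -/
structure Coloring {P ι : Type} (F : ι → Set P) (n : ℕ) where
  color : ι → TwoTorus n
  linInd : ∀ x : P, LinearIndependent (ZMod 2) (fun i : {i // x ∈ F i} => color i)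

/-- The coloring `σ ∘ l`, for an automorphism `σ` of `(ℤ/2)^n`. -/
def Coloring.comp {P ι : Type} {F : ι → Set P} {n : ℕ}
    (s : TwoTorus n ≃ₗ[ZMod 2] TwoTorus n) (l : Coloring F n) : Coloring F n where
  color i := s (l.color i)
  linInd x := (l.linInd x).map' s.toLinearMap s.ker

/-- `G_x`: the subgroup of `(ℤ/2)^n` generated by the colors of the facets through `x`.
It is `0` if `x` is an interior point. -/
def Coloring.isotropy {P ι : Type} {F : ι → Set P} {n : ℕ} (l : Coloring F n) (x : P) :
    AddSubgroup (TwoTorus n) :=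
  AddSubgroup.closure {c | ∃ i, x ∈ F i ∧ c = l.color i}

/-- `(x, g) ∼ (y, h)` iff `x = y` and `g - h ∈ G_x`. -/
def Coloring.gluing {P ι : Type} {F : ι → Set P} {n : ℕ} (l : Coloring F n) :
    Setoid (P × TwoTorus n) where
  r a b := a.1 = b.1 ∧ a.2 - b.2 ∈ l.isotropy a.1
  iseqv :=
    { refl := fun a => ⟨rfl, by simp [(l.isotropy a.1).zero_mem]⟩
      symm := fun {a b} h => ⟨h.1.symm, by
        have := (l.isotropy a.1).neg_mem h.2
        rw [neg_sub, h.1] at this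
        exact this⟩
      trans := fun {a b c} h k => ⟨h.1.trans k.1, by
        have h2 := k.2
        rw [← h.1] at h2
        have := (l.isotropy a.1).add_mem h.2 h2
        rwa [sub_add_sub_cancel] at this⟩ }

/-- The small cover `M(P, l) = P × (ℤ/2)^n / ∼`. -/
def SmallCover {P ι : Type} {F : ι → Set P} {n : ℕ} (l : Coloring F n) : Type :=
  Quotient l.gluing

/-- `M(P, l)` has the quotient topology of the product topology (`(ℤ/2)^n` being discrete). -/
instance SmallCover.instTopologicalSpace {P ι : Type} [TopologicalSpace P] {F : ι → Set P} {n : ℕ}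
    (l : Coloring F n) : TopologicalSpace (SmallCover l) :=
  inferInstanceAs (TopologicalSpace (Quotient l.gluing))

/-- A `(ℤ/2)^n`-action on the set `X`. -/
abbrev TwoTorusAction (n : ℕ) (X : Type) : Type :=
  Multiplicative (TwoTorus n) →* Equiv.Perm X

/-- An action of the additive group `(ℤ/2)^n` from its operators and the action laws. -/
def TwoTorusAction.mk' {n : ℕ} {X : Type} (f : TwoTorus n → X → X) (h0 : ∀ x, f 0 x = x)
    (hadd : ∀ g h x, f (g + h) x = f g (f h x)) : TwoTorusAction n X where
  toFun g :=
    { toFun := f g.toAdd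
      invFun := f (-g.toAdd)
      left_inv := fun x => by rw [← hadd, neg_add_cancel, h0]
      right_inv := fun x => by rw [← hadd, add_neg_cancel, h0] }
  map_one' := Equiv.ext fun x => h0 x
  map_mul' g h := Equiv.ext fun x => hadd g.toAdd h.toAdd x

/-- The action on `M(P, l)`: `h · [x, g] = [x, h + g]`. -/
def SmallCover.action {P ι : Type} {F : ι → Set P} {n : ℕ} (l : Coloring F n) :
    TwoTorusAction n (SmallCover l) :=
  TwoTorusAction.mk'
    (fun h => Quotient.map (fun a => (a.1, h + a.2)) (fun a b hab => ⟨hab.1, by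
      have e : (h + a.2) - (h + b.2) = a.2 - b.2 := add_sub_add_left_eq_sub _ _ _
      exact e ▸ hab.2⟩))
    (fun x => Quotient.inductionOn x fun a =>
      congrArg (Quotient.mk _) (Prod.ext rfl (zero_add a.2)))
    (fun g h x => Quotient.inductionOn x fun a => congrArg (Quotient.mk _) (by simp [add_assoc]))

/-- Two `(ℤ/2)^n`-spaces are `σ`-equivariantly homeomorphic: there is a homeomorphism `f` with
`f (g · x) = σ(g) · f(x)`. -/
def TwistedEquivariantlyHomeomorphic {n : ℕ} {X Y : Type} [TopologicalSpace X] [TopologicalSpace Y]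
    (s : TwoTorus n ≃ₗ[ZMod 2] TwoTorus n) (a : TwoTorusAction n X) (b : TwoTorusAction n Y) :
    Prop :=
  ∃ f : X ≃ₜ Y, ∀ (g : TwoTorus n) (x : X),
    f (a (Multiplicative.ofAdd g) x) = b (Multiplicative.ofAdd (s g)) (f x)

/-- Two `(ℤ/2)^n`-spaces are equivariantly homeomorphic: there is a homeomorphism `f` with
`f (g · x) = g · f(x)`. -/
def EquivariantlyHomeomorphic {n : ℕ} {X Y : Type} [TopologicalSpace X] [TopologicalSpace Y]
    (a : TwoTorusAction n X) (b : TwoTorusAction n Y) : Prop :=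
  ∃ f : X ≃ₜ Y, ∀ (g : TwoTorus n) (x : X),
    f (a (Multiplicative.ofAdd g) x) = b (Multiplicative.ofAdd g) (f x)

/-! ## The simplex, the prism and their colorings -/

/-- The `3`-simplex. -/
abbrev Simplex3 : Type := stdSimplex ℝ (Fin 4)

/-- The facet `x_i = 0` of the `3`-simplex. -/
def simplexFacet (i : Fin 4) : Set Simplex3 := {x | x.1 i = 0}

/-- The `3`-sided prism, as the product of a `1`-simplex and a `2`-simplex. -/
abbrev Prism3 : Type := stdSimplex ℝ (Fin 2) × stdSimplex ℝ (Fin 3)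

/-- The facets of the prism: `inl j` are the two triangles, `inr k` the three squares. -/
def prismFacet : Fin 2 ⊕ Fin 3 → Set Prism3
  | .inl j => {x | x.1.1 j = 0}
  | .inr k => {x | x.2.1 k = 0}

/-- A family whose only relation supported on the indices in `S` is the trivial one
is linearly independent on `S`. -/
theorem linearIndependent_of_supported {ι V : Type} [Fintype ι] [AddCommGroup V]
    [Module (ZMod 2) V] (c : ι → V) (S : ι → Prop)
    (h : ∀ G : ι → ZMod 2, (∀ i, ¬ S i → G i = 0) → ∑ i, G i • c i = 0 → G = 0) :
    LinearIndependent (ZMod 2) (fun i : {i // S i} => c i) := by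
  classical
  rw [Fintype.linearIndependent_iff]
  intro g hg i
  have key := h (fun i => if hi : S i then g ⟨i, hi⟩ else 0) (fun i hi => by simp [hi]) (by
    rw [← hg, ← Fintype.sum_subtype_add_sum_subtype S]
    have h1 : ∀ x : {x // S x}, (if hi : S x.1 then g ⟨x.1, hi⟩ else 0) = g x := fun x => by
      simp [x.2]
    have h2 : ∀ x : {x // ¬ S x}, (if hi : S x.1 then g ⟨x.1, hi⟩ else 0) = 0 := fun x => by
      simp [x.2]
    simp [h1, h2])
  simpa [i.2] using congrFun key i.1

theorem stdSimplex_exists_ne_zero {ι : Type} [Fintype ι] (x : stdSimplex ℝ ι) :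
    ∃ i, x.1 i ≠ 0 := by
  by_contra! h
  have := x.2.2
  simp [h] at this

/-- The coloring `λ₀` of the `3`-simplex: the facets `x_0 = 0`, `x_1 = 0`, `x_2 = 0`, `x_3 = 0` have
the colors `e_1 + e_2 + e_3`, `e_1`, `e_2`, `e_3`. -/
def lambda0 : Coloring simplexFacet 3 where
  color := ![![1, 1, 1], ![1, 0, 0], ![0, 1, 0], ![0, 0, 1]]
  linInd x := by
    refine linearIndependent_of_supported _ (fun i => x ∈ simplexFacet i) fun G hG => ?_
    obtain ⟨i, hi⟩ := stdSimplex_exists_ne_zero x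
    have hi' := hG i hi
    clear hG hi
    revert i G
    clear x
    decide +kernel

/-- The colors of the facets of the prism: `e_1` and `c` on the triangles, `e_2 + e_3`, `e_2`, `e_3`
on the squares. -/
def prismColor (c : TwoTorus 3) : Fin 2 ⊕ Fin 3 → TwoTorus 3 :=
  Sum.elim ![![1, 0, 0], c] ![![0, 1, 1], ![0, 1, 0], ![0, 0, 1]]

/-- `prismColor c` is a coloring of the prism if the first coordinate of `c` is `1`. -/
def prismColoring (c : TwoTorus 3) (hc : c 0 = 1) : Coloring prismFacet 3 where
  color := prismColor c
  linInd x := by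
    refine linearIndependent_of_supported _ (fun i => x ∈ prismFacet i) fun G hG => ?_
    obtain ⟨j, hj⟩ := stdSimplex_exists_ne_zero x.1
    obtain ⟨k, hk⟩ := stdSimplex_exists_ne_zero x.2
    have hj' := hG (.inl j) hj
    have hk' := hG (.inr k) hk
    intro hs
    have key : ∀ (c : TwoTorus 3), c 0 = 1 → ∀ (j : Fin 2) (k : Fin 3)
        (a : Fin 2 → ZMod 2) (b : Fin 3 → ZMod 2), a j = 0 → b k = 0 →
        ∑ i, Sum.elim a b i • prismColor c i = 0 → a = 0 ∧ b = 0 := by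
      decide +kernel
    have := key c hc j k (G ∘ Sum.inl) (G ∘ Sum.inr) hj' hk' (by rwa [Sum.elim_comp_inl_inr])
    funext i
    rcases i with i | i
    · exact congrFun this.1 i
    · exact congrFun this.2 i

/-- The coloring `λ₁` of the prism: triangles `e_1`, `e_1`; squares `e_2 + e_3`, `e_2`, `e_3`. -/
def lambda1 : Coloring prismFacet 3 := prismColoring ![1, 0, 0] rfl

/-- The coloring `λ₂` of the prism: triangles `e_1`, `e_1 + e_2`; squares `e_2 + e_3`, `e_2`, `e_3`. -/
def lambda2 : Coloring prismFacet 3 := prismColoring ![1, 1, 0] rfl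

/-- The coloring `λ₃` of the prism: triangles `e_1`, `e_1 + e_3`; squares `e_2 + e_3`, `e_2`, `e_3`. -/
def lambda3 : Coloring prismFacet 3 := prismColoring ![1, 0, 1] rfl

/-- The coloring `λ₄` of the prism: triangles `e_1`, `e_1 + e_2 + e_3`; squares `e_2 + e_3`, `e_2`,
`e_3`. -/
def lambda4 : Coloring prismFacet 3 := prismColoring ![1, 1, 1] rfl

/-! ## Projective spaces and the linear actions -/

/-- The projectivization of a topological vector space has the quotient topology. -/
instance Projectivization.instQuotientTopology {V : Type} [AddCommGroup V] [Module ℝ V]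
    [TopologicalSpace V] : TopologicalSpace (ℙ ℝ V) :=
  inferInstanceAs (TopologicalSpace (Quotient (projectivizationSetoid ℝ V)))

/-- `ℝP^n`, with homogeneous coordinates `[x_0, …, x_n]`. -/
abbrev RP (n : ℕ) : Type := ℙ ℝ (Fin (n + 1) → ℝ)

/-- The sign `(-1)^a`, as a unit of `ℝ`. -/
def signUnit (a : ZMod 2) : ℝˣ := if a = 0 then 1 else -1

theorem signUnit_add (a b : ZMod 2) : signUnit (a + b) = signUnit a * signUnit b := by
  have h : (1 + 1 : ZMod 2) = 0 := rfl
  have h01 : ∀ c : ZMod 2, c = 0 ∨ c = 1 := by decide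
  rcases h01 a with rfl | rfl <;> rcases h01 b with rfl | rfl <;> simp [signUnit, h]

/-- The linear map `(x_0, x_1, …, x_n) ↦ (x_0, ± x_1, …, ± x_n)`, with the signs `(-1)^(g i)`. -/
def signMap {n : ℕ} (g : TwoTorus n) : (Fin (n + 1) → ℝ) ≃ₗ[ℝ] (Fin (n + 1) → ℝ) :=
  LinearEquiv.piCongrRight fun i =>
    LinearEquiv.smulOfUnit (Fin.cons (α := fun _ => ℝˣ) 1 (fun j => signUnit (g j)) i)

theorem signMap_zero {n : ℕ} (x : Fin (n + 1) → ℝ) : signMap (0 : TwoTorus n) x = x := by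
  funext i
  refine Fin.cases ?_ (fun j => ?_) i <;> simp [signMap, LinearEquiv.smulOfUnit, signUnit]

theorem signMap_add {n : ℕ} (g h : TwoTorus n) (x : Fin (n + 1) → ℝ) :
    signMap (g + h) x = signMap g (signMap h x) := by
  funext i
  refine Fin.cases ?_ (fun j => ?_) i <;>
    simp [signMap, LinearEquiv.smulOfUnit, signUnit_add, mul_smul]

/-- The map `[x_0, x_1, …, x_n] ↦ [x_0, ± x_1, …, ± x_n]` of `ℝP^n`. -/
def linearActionMap {n : ℕ} (g : TwoTorus n) : RP n → RP n :=
  Projectivization.map (signMap g).toLinearMap (signMap g).injective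

theorem linearActionMap_zero {n : ℕ} (p : RP n) : linearActionMap 0 p = p := by
  induction p using Projectivization.ind with
  | h v hv => simp [linearActionMap, Projectivization.map_mk, signMap_zero]

theorem linearActionMap_add {n : ℕ} (g h : TwoTorus n) (p : RP n) :
    linearActionMap (g + h) p = linearActionMap g (linearActionMap h p) := by
  induction p using Projectivization.ind with
  | h v hv => simp [linearActionMap, Projectivization.map_mk, signMap_add]

/-- The canonical linear action on `ℝP^n`. -/
def linearAction (n : ℕ) : TwoTorusAction n (RP n) :=
  TwoTorusAction.mk' linearActionMap linearActionMap_zero linearActionMap_add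

/-- The action `(x_0, x_1) ↦ (x_0, ± x_1)` of `ℤ/2` on the unit circle: complex conjugation, which
on the unit circle is the inversion. -/
def circleConj (a : ZMod 2) (z : Circle) : Circle := if a = 0 then z else z⁻¹

theorem circleConj_add (a b : ZMod 2) (z : Circle) :
    circleConj (a + b) z = circleConj a (circleConj b z) := by
  have h : (1 + 1 : ZMod 2) = 0 := rfl
  have h01 : ∀ c : ZMod 2, c = 0 ∨ c = 1 := by decide
  rcases h01 a with rfl | rfl <;> rcases h01 b with rfl | rfl <;> simp [circleConj, h]

/-- The product linear action `φ₁` on `S¹ × ℝP²`: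
`((x_0, x_1), [y_0, y_1, y_2]) ↦ ((x_0, g_1 x_1), [y_0, g_2 y_1, g_3 y_2])`. -/
def phi1 : TwoTorusAction 3 (Circle × RP 2) :=
  TwoTorusAction.mk'
    (fun g p => (circleConj (g 0) p.1, linearActionMap ![g 1, g 2] p.2))
    (fun p => Prod.ext (by simp [circleConj]) (by
      have h : (![(0 : TwoTorus 3) 1, (0 : TwoTorus 3) 2] : TwoTorus 2) = 0 := by decide
      simp only [h, linearActionMap_zero]))
    (fun g h p => Prod.ext (circleConj_add _ _ _) (by
      have e : (![(g + h) 1, (g + h) 2] : TwoTorus 2) = ![g 1, g 2] + ![h 1, h 2] := by simp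
      simp only [e, linearActionMap_add]))

/-! ## Actions on `S¹ × ℝP(ℂ ⊕ ℝ)` given by three commuting involutions -/

/-- The action of `(ℤ/2)^3` in which the standard basis vectors act by three given commuting
involutions `t₁`, `t₂`, `t₃`: the element `g` acts by `t₁^(g_1) t₂^(g_2) t₃^(g_3)`. -/
def actionOfInvolutions {X : Type} (t₁ t₂ t₃ : X → X)
    (h₁ : Function.Involutive t₁) (h₂ : Function.Involutive t₂) (h₃ : Function.Involutive t₃)
    (h₁₂ : Function.Commute t₁ t₂) (h₁₃ : Function.Commute t₁ t₃) (h₂₃ : Function.Commute t₂ t₃) :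
    TwoTorusAction 3 X :=
  TwoTorusAction.mk'
    (fun g x => t₁^[(g 0).val] (t₂^[(g 1).val] (t₃^[(g 2).val] x)))
    (fun x => by simp)
    (fun g h x => by
      have key : ∀ t : X → X, Function.Involutive t → ∀ a b : ZMod 2, ∀ y,
          t^[(a + b).val] y = t^[a.val] (t^[b.val] y) := by
        intro t ht a b y
        fin_cases a <;> fin_cases b
        · rfl
        · rfl
        · rfl
        · exact (ht y).symm
      have c₁₂ := fun a b y => (h₁₂.iterate_iterate a b).eq y
      have c₁₃ := fun a b y => (h₁₃.iterate_iterate a b).eq y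
      have c₂₃ := fun a b y => (h₂₃.iterate_iterate a b).eq y
      simp only [Pi.add_apply, key t₁ h₁, key t₂ h₂, key t₃ h₃, c₁₂, c₁₃, c₂₃])

/-- `ℝP² = ℝP(ℂ ⊕ ℝ)`, with homogeneous coordinates `[v, w]`. -/
abbrev RPCR : Type := ℙ ℝ (ℂ × ℝ)

/-- `[v, w] ↦ [u v, w]`, for `u` in the unit circle. -/
def rot (u : Circle) : RPCR → RPCR :=
  Projectivization.map
    (((rotation u).toLinearEquiv.prodCongr (LinearEquiv.refl ℝ ℝ)).toLinearMap)
    ((rotation u).toLinearEquiv.prodCongr (LinearEquiv.refl ℝ ℝ)).injective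

/-- `[v, w] ↦ [u v̄, w]`, for `u` in the unit circle. -/
def conjRot (u : Circle) : RPCR → RPCR :=
  Projectivization.map
    (((Complex.conjLIE.trans (rotation u)).toLinearEquiv.prodCongr
      (LinearEquiv.refl ℝ ℝ)).toLinearMap)
    ((Complex.conjLIE.trans (rotation u)).toLinearEquiv.prodCongr (LinearEquiv.refl ℝ ℝ)).injective

theorem circle_mul_ne (u : Circle) (v : ℂ) (w : ℝ) (h : (v, w) ≠ 0) :
    ((u : ℂ) * v, w) ≠ 0 := by
  simpa [Prod.ext_iff] using h

theorem circle_mul_conj_ne (u : Circle) (v : ℂ) (w : ℝ) (h : (v, w) ≠ 0) :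
    ((u : ℂ) * (starRingEnd ℂ) v, w) ≠ 0 := by
  simpa [Prod.ext_iff] using h

theorem rot_mk (u : Circle) (v : ℂ) (w : ℝ) (h : (v, w) ≠ 0) :
    rot u (Projectivization.mk ℝ (v, w) h) =
      Projectivization.mk ℝ ((u : ℂ) * v, w) (circle_mul_ne u v w h) := rfl

theorem conjRot_mk (u : Circle) (v : ℂ) (w : ℝ) (h : (v, w) ≠ 0) :
    conjRot u (Projectivization.mk ℝ (v, w) h) =
      Projectivization.mk ℝ ((u : ℂ) * (starRingEnd ℂ) v, w) (circle_mul_conj_ne u v w h) := rfl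

theorem rot_one (p : RPCR) : rot 1 p = p := by
  induction p using Projectivization.ind with
  | h x hx => obtain ⟨v, w⟩ := x; simp [rot_mk]

theorem rot_rot (a b : Circle) (p : RPCR) : rot a (rot b p) = rot (a * b) p := by
  induction p using Projectivization.ind with
  | h x hx => obtain ⟨v, w⟩ := x; simp [rot_mk, mul_assoc]

theorem rot_conjRot (a b : Circle) (p : RPCR) : rot a (conjRot b p) = conjRot (a * b) p := by
  induction p using Projectivization.ind with
  | h x hx => obtain ⟨v, w⟩ := x; simp [rot_mk, conjRot_mk, mul_assoc]

theorem conjRot_rot (a b : Circle) (p : RPCR) : conjRot a (rot b p) = conjRot (a * b⁻¹) p := by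
  induction p using Projectivization.ind with
  | h x hx =>
    obtain ⟨v, w⟩ := x
    simp [rot_mk, conjRot_mk, mul_assoc, ← Circle.coe_inv_eq_conj]

theorem conjRot_conjRot (a b : Circle) (p : RPCR) : conjRot a (conjRot b p) = rot (a * b⁻¹) p := by
  induction p using Projectivization.ind with
  | h x hx =>
    obtain ⟨v, w⟩ := x
    simp [rot_mk, conjRot_mk, mul_assoc, ← Circle.coe_inv_eq_conj]

/-- The action `φ₂` on `S¹ × ℝP²`. On the unit circle, `z̄ = z⁻¹`.
`t₁ (z, [v, w]) = (z̄, [z v, w])`, `t₂ (z, [v, w]) = (z, [- z̄ v̄, w])`,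
`t₃ (z, [v, w]) = (z̄, [- z v, w])`. -/
def phi2 : TwoTorusAction 3 (Circle × RPCR) :=
  actionOfInvolutions
    (fun p => (p.1⁻¹, rot p.1 p.2))
    (fun p => (p.1, conjRot (-p.1⁻¹) p.2))
    (fun p => (p.1⁻¹, rot (-p.1) p.2))
    (fun p => by simp [rot_rot, rot_one])
    (fun p => by simp [conjRot_conjRot, rot_one])
    (fun p => by simp [rot_rot, rot_one])
    (fun p => by simp [rot_conjRot, conjRot_rot])
    (fun p => by simp [rot_rot])
    (fun p => by simp [rot_conjRot, conjRot_rot])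

/-- The action `φ₃` on `S¹ × ℝP²`.
`t₁ (z, [v, w]) = (z̄, [z v, w])`, `t₂ (z, [v, w]) = (z, [z̄ v̄, w])`,
`t₃ (z, [v, w]) = (z̄, [- z v, w])`. -/
def phi3 : TwoTorusAction 3 (Circle × RPCR) :=
  actionOfInvolutions
    (fun p => (p.1⁻¹, rot p.1 p.2))
    (fun p => (p.1, conjRot p.1⁻¹ p.2))
    (fun p => (p.1⁻¹, rot (-p.1) p.2))
    (fun p => by simp [rot_rot, rot_one])
    (fun p => by simp [conjRot_conjRot, rot_one])
    (fun p => by simp [rot_rot, rot_one])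
    (fun p => by simp [rot_conjRot, conjRot_rot])
    (fun p => by simp [rot_rot])
    (fun p => by simp [rot_conjRot, conjRot_rot])

/-- The action `φ₄` on `S¹ × ℝP²`.
`t₁ (z, [v, w]) = (z̄, [z̄ v, w])`, `t₂ (z, [v, w]) = (z, [z v̄, w])`,
`t₃ (z, [v, w]) = (z, [- z v̄, w])`. -/
def phi4 : TwoTorusAction 3 (Circle × RPCR) :=
  actionOfInvolutions
    (fun p => (p.1⁻¹, rot p.1⁻¹ p.2))
    (fun p => (p.1, conjRot p.1 p.2))
    (fun p => (p.1, conjRot (-p.1) p.2))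
    (fun p => by simp [rot_rot, rot_one])
    (fun p => by simp [conjRot_conjRot, rot_one])
    (fun p => by simp [conjRot_conjRot, rot_one])
    (fun p => by simp [rot_conjRot, conjRot_rot])
    (fun p => by simp [rot_conjRot, conjRot_rot])
    (fun p => by simp [conjRot_conjRot])

/-! ## Two automorphisms of `(ℤ/2)^3` -/

/-- The automorphism `e_1 ↦ e_1`, `e_2 ↦ e_1 + e_3`, `e_3 ↦ e_2`. -/
def sigma2 : TwoTorus 3 ≃ₗ[ZMod 2] TwoTorus 3 where
  toFun g := ![g 0 + g 1, g 2, g 1]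
  invFun g := ![g 0 + g 2, g 2, g 1]
  map_add' := by decide +kernel
  map_smul' := by decide +kernel
  left_inv := by decide +kernel
  right_inv := by decide +kernel

/-- The automorphism `e_1 ↦ e_1`, `e_2 ↦ e_2`, `e_3 ↦ e_1 + e_3`. -/
def sigma3 : TwoTorus 3 ≃ₗ[ZMod 2] TwoTorus 3 where
  toFun g := ![g 0 + g 2, g 1, g 2]
  invFun g := ![g 0 + g 2, g 1, g 2]
  map_add' := by decide +kernel
  map_smul' := by decide +kernel
  left_inv := by decide +kernel
  right_inv := by decide +kernel

end

/-!
Each homeomorphism is the map `[x, g] ↦ g · s x` attached to an explicit continuous map `s` of the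
polytope `P` into the target space. If `s` is a strict fundamental domain, and the stabilizer of
`s x` is generated by the colors of the facets through `x`, this map is a well-defined continuous
equivariant bijection, hence a homeomorphism, because `P × (ℤ/2)^n` is compact and the target is
Hausdorff (`equivariantlyHomeomorphic_of_fundamentalDomain`).

For `ℝP^n`, barycentric coordinates on the simplex are taken as homogeneous coordinates: `s x = [x]`.
The facet `x_i = 0` is fixed by the change of the sign of `x_i`; for `i = 0` this is, projectively,
the change of the signs of all the other coordinates, whence the color `e_1 + ⋯ + e_n`
(`eq_of_linearActionMap_eq`).

For the prism `Δ¹ × Δ²`, the edge `Δ¹` is mapped to the upper half circle by `t ↦ z = exp (i π t_0)`,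
and `Δ²` is mapped to the fiber over `z` by a trivialization `j t : ℝP² → Y`, as in the case of
`ℝP²`. This is a fundamental domain if the colors of the squares act in the trivializations as the
standard reflections, and if the color of each triangle, which lies over complex conjugation of `z`,
is trivial on the fiber over the corresponding end `z = 1` or `z = -1`
(`equivariantlyHomeomorphic_prism`). For `φ₁` the trivialization is constant. For `φ₂`, `φ₃`, `φ₄` it
is the rotation of the `ℂ`-coordinate by a square root of `z` or of `z⁻¹`, after a permutation of the
homogeneous coordinates: along each half circle from `1` to `-1` it turns by a right angle, in
opposite senses, so that the two trivializations over `-1` differ by a half turn of the fiber, and so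
do the colors of the two triangles. The automorphisms `σ₂` and `σ₃` are absorbed into the action on
the target.
-/

open scoped LinearAlgebra.Projectivization

/-! ### Recognizing a small cover from a fundamental domain -/

/-- A fundamental domain determines the action. If `s` embeds the polytope `P` in a compact
Hausdorff `(ℤ/2)^n`-space as a strict fundamental domain, in such a way that the stabilizer of `s x`
is generated by the colors of the facets through `x`, then the space is the small cover: the map
`[x, g] ↦ g · s x` is a continuous equivariant bijection from a compact space to a Hausdorff one. -/
theorem equivariantlyHomeomorphic_of_fundamentalDomain {P ι X : Type} [TopologicalSpace P]
    [CompactSpace P] [TopologicalSpace X] [T2Space X] {F : ι → Set P} {n : ℕ} (l : Coloring F n)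
    (b : TwoTorusAction n X) (hb : ∀ g, Continuous (b (Multiplicative.ofAdd g)))
    (s : P → X) (hs : Continuous s)
    (hfix : ∀ i x, x ∈ F i → b (Multiplicative.ofAdd (l.color i)) (s x) = s x)
    (hinj : ∀ g x y, b (Multiplicative.ofAdd g) (s x) = s y → x = y ∧ g ∈ l.isotropy x)
    (hsurj : ∀ p, ∃ g x, b (Multiplicative.ofAdd g) (s x) = p) :
    EquivariantlyHomeomorphic (SmallCover.action l) b := by
  have add_apply : ∀ g h p, b (Multiplicative.ofAdd (g + h)) p =
      b (Multiplicative.ofAdd g) (b (Multiplicative.ofAdd h) p) := fun g h p => by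
    rw [ofAdd_add, map_mul, Equiv.Perm.mul_apply]
  have zero_apply : ∀ p, b (Multiplicative.ofAdd 0) p = p := fun p => by
    rw [ofAdd_zero, map_one, Equiv.Perm.one_apply]
  have stab : ∀ x, ∀ g ∈ l.isotropy x, b (Multiplicative.ofAdd g) (s x) = s x := by
    intro x g hg
    induction hg using AddSubgroup.closure_induction with
    | mem c hc => obtain ⟨i, hi, rfl⟩ := hc; exact hfix i x hi
    | zero => exact zero_apply _
    | add a c _ _ ha hc => rw [add_apply, hc, ha]
    | neg a _ ha => rw [← ha, ← add_apply, neg_add_cancel, zero_apply, ha]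
  let f : SmallCover l → X := Quotient.lift (fun a => b (Multiplicative.ofAdd a.2) (s a.1)) (by
    rintro ⟨x, g⟩ ⟨y, h⟩ ⟨hxy, hgh⟩
    obtain rfl : x = y := hxy
    have := stab x _ hgh
    change b (Multiplicative.ofAdd g) (s x) = b (Multiplicative.ofAdd h) (s x)
    rw [← add_sub_cancel h g, add_apply, this])
  have hf : Continuous f := by
    refine Continuous.quotient_lift ?_ _
    exact continuous_prod_of_discrete_right.2 fun g => (hb g).comp hs
  have f_inj : Function.Injective f := by
    intro p q
    refine Quotient.inductionOn₂ p q fun ⟨x, g⟩ ⟨y, h⟩ hpq => Quotient.sound ?_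
    change b (Multiplicative.ofAdd g) (s x) = b (Multiplicative.ofAdd h) (s y) at hpq
    have : b (Multiplicative.ofAdd (-h + g)) (s x) = s y := by
      rw [add_apply, hpq, ← add_apply, neg_add_cancel, zero_apply]
    obtain ⟨hxy, hg⟩ := hinj _ _ _ this
    exact ⟨hxy, by rwa [neg_add_eq_sub] at hg⟩
  have f_surj : Function.Surjective f := fun p =>
    let ⟨g, x, h⟩ := hsurj p
    ⟨Quotient.mk _ (x, g), h⟩
  have : CompactSpace (SmallCover l) :=
    inferInstanceAs (CompactSpace (Quotient l.gluing))
  refine ⟨Continuous.homeoOfEquivCompactToT2 (f := Equiv.ofBijective f ⟨f_inj, f_surj⟩) hf, ?_⟩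
  intro g p
  refine Quotient.inductionOn p fun ⟨x, h⟩ => ?_
  exact add_apply g h (s x)

/-- Twisting the target action by `σ` is the same as asking for a `σ`-equivariant homeomorphism. -/
theorem EquivariantlyHomeomorphic.twisted {n : ℕ} {X Y : Type} [TopologicalSpace X]
    [TopologicalSpace Y] {σ : TwoTorus n ≃ₗ[ZMod 2] TwoTorus n} {a : TwoTorusAction n X}
    {b : TwoTorusAction n Y}
    (h : EquivariantlyHomeomorphic a (b.comp (AddMonoidHom.toMultiplicative σ.toAddMonoidHom))) :
    TwistedEquivariantlyHomeomorphic σ a b := h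

theorem Coloring.mem_isotropy_comp {P ι : Type} {F : ι → Set P} {n : ℕ}
    (σ : TwoTorus n ≃ₗ[ZMod 2] TwoTorus n) (l : Coloring F n) (x : P) (g : TwoTorus n) :
    σ g ∈ (l.comp σ).isotropy x ↔ g ∈ l.isotropy x := by
  have : (l.comp σ).isotropy x = (l.isotropy x).map σ.toAddMonoidHom := by
    rw [Coloring.isotropy, Coloring.isotropy, AddMonoidHom.map_closure]
    congr 1
    ext c
    constructor
    · rintro ⟨i, hi, rfl⟩
      exact ⟨_, ⟨i, hi, rfl⟩, rfl⟩
    · rintro ⟨_, ⟨i, hi, rfl⟩, rfl⟩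
      exact ⟨i, hi, rfl⟩
  rw [this]
  exact AddSubgroup.mem_map_iff_mem (f := σ.toAddMonoidHom) σ.injective

/-- A `σ`-equivariant homeomorphism from `M(P, l)` is an equivariant one from `M(P, σ ∘ l)`,
because `[x, g] ↦ [x, σ g]` identifies these two small covers. -/
theorem TwistedEquivariantlyHomeomorphic.comp {P ι Y : Type} [TopologicalSpace P]
    [TopologicalSpace Y] {F : ι → Set P} {n : ℕ} {l : Coloring F n}
    {σ : TwoTorus n ≃ₗ[ZMod 2] TwoTorus n} {b : TwoTorusAction n Y}
    (h : TwistedEquivariantlyHomeomorphic σ (SmallCover.action l) b) :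
    EquivariantlyHomeomorphic (SmallCover.action (l.comp σ)) b := by
  obtain ⟨f, hf⟩ := h
  have rel : ∀ a c : P × TwoTorus n, l.gluing a c ↔
      (l.comp σ).gluing (a.1, σ a.2) (c.1, σ c.2) := fun a c => by
    refine and_congr Iff.rfl ?_
    change _ ↔ σ a.2 - σ c.2 ∈ (l.comp σ).isotropy a.1
    rw [← map_sub, Coloring.mem_isotropy_comp]
  let e : SmallCover l ≃ₜ SmallCover (l.comp σ) :=
    { toEquiv := Quotient.congr ((Equiv.refl P).prodCongr σ.toEquiv) rel
      continuous_toFun := by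
        refine continuous_quot_lift _ (continuous_quotient_mk'.comp ?_)
        exact continuous_fst.prodMk (continuous_of_discreteTopology.comp continuous_snd)
      continuous_invFun := by
        refine continuous_quot_lift _ (continuous_quotient_mk'.comp ?_)
        exact continuous_fst.prodMk (continuous_of_discreteTopology.comp continuous_snd) }
  have he : ∀ g p, e (SmallCover.action l (Multiplicative.ofAdd g) p) =
      SmallCover.action (l.comp σ) (Multiplicative.ofAdd (σ g)) (e p) := fun g p =>
    Quotient.inductionOn p fun a => congrArg (Quotient.mk _) (Prod.ext rfl (map_add σ g a.2))
  refine ⟨e.symm.trans f, fun g p => ?_⟩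
  obtain ⟨q, rfl⟩ := e.surjective p
  obtain ⟨g, rfl⟩ := σ.surjective g
  rw [← he]
  simpa using hf g q

/-! ### The topology of real projective spaces -/

namespace Projectivization

theorem isOpenQuotientMap_mk' {V : Type} [NormedAddCommGroup V] [NormedSpace ℝ V] :
    IsOpenQuotientMap (Projectivization.mk' ℝ : {v : V // v ≠ 0} → ℙ ℝ V) := by
  refine ⟨Quot.mk_surjective, continuous_quot_mk, fun U hU => ?_⟩
  change IsOpen ((Projectivization.mk' ℝ : {v : V // v ≠ 0} → ℙ ℝ V) ⁻¹' _)
  -- the saturation of `U` is the union of its translates by the homotheties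
  have : Projectivization.mk' ℝ ⁻¹' (Projectivization.mk' ℝ '' U) = ⋃ c : ℝˣ,
      (fun v : {v : V // v ≠ 0} =>
        (⟨c • v.1, (smul_ne_zero_iff_ne c).2 v.2⟩ : {v : V // v ≠ 0})) ⁻¹' U := by
    ext v
    simp only [Set.mem_preimage, Set.mem_image, Set.mem_iUnion, mk'_eq_mk, mk_eq_mk_iff]
    constructor
    · rintro ⟨w, hw, c, hc⟩
      exact ⟨c, by simpa [hc] using hw⟩
    · rintro ⟨c, hc⟩
      exact ⟨_, hc, c, rfl⟩
  rw [this]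
  refine isOpen_iUnion fun c => hU.preimage ?_
  exact (continuous_subtype_val.const_smul c).subtype_mk _

instance instT2Space {V : Type} [NormedAddCommGroup V] [NormedSpace ℝ V] : T2Space (ℙ ℝ V) := by
  rw [t2Space_iff_of_isOpenQuotientMap isOpenQuotientMap_mk']
  have : {q : {v : V // v ≠ 0} × {v : V // v ≠ 0} |
      Projectivization.mk' ℝ q.1 = Projectivization.mk' ℝ q.2} =
      (fun q => ![q.1.1, q.2.1]) ⁻¹' {f : Fin 2 → V | LinearIndependent ℝ f}ᶜ := by
    ext q
    have h := independent_pair_iff_ne (Projectivization.mk' ℝ q.1) (Projectivization.mk' ℝ q.2)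
    rw [mk'_eq_mk, mk'_eq_mk, ne_eq, mk_eq_mk_iff'] at *
    simp only [Set.mem_ofPred_eq, Set.mem_preimage, Set.mem_compl_iff, linearIndependent_fin2,
      mk'_eq_mk, mk_eq_mk_iff']
    simp [q.2.2]
  rw [this]
  refine isOpen_setOfPred_linearIndependent.isClosed_compl.preimage ?_
  refine continuous_pi fun i => ?_
  fin_cases i
  · exact continuous_subtype_val.comp continuous_fst
  · exact continuous_subtype_val.comp continuous_snd

theorem continuous_mk {V T : Type} [NormedAddCommGroup V] [NormedSpace ℝ V] [TopologicalSpace T]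
    {f : T → V} (hf : Continuous f) (h0 : ∀ t, f t ≠ 0) :
    Continuous fun t => Projectivization.mk ℝ (f t) (h0 t) :=
  continuous_quot_mk.comp (hf.subtype_mk h0)

/-- A continuous family of injective linear maps acts continuously on the projective space. -/
theorem continuous_map_family {V W T : Type} [NormedAddCommGroup V] [NormedSpace ℝ V]
    [NormedAddCommGroup W] [NormedSpace ℝ W] [TopologicalSpace T] (A : T → V →ₗ[ℝ] W)
    (hA : ∀ t, Function.Injective (A t)) (hc : Continuous fun q : T × V => A q.1 q.2) :
    Continuous fun q : T × ℙ ℝ V => Projectivization.map (A q.1) (hA q.1) q.2 := by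
  rw [← (IsOpenQuotientMap.id.prodMap isOpenQuotientMap_mk').continuous_comp_iff]
  refine continuous_mk (f := fun q : T × {v : V // v ≠ 0} => A q.1 q.2) ?_ _
  exact hc.comp (continuous_fst.prodMk (continuous_subtype_val.comp continuous_snd))

theorem continuous_map {V W : Type} [NormedAddCommGroup V] [NormedSpace ℝ V]
    [NormedAddCommGroup W] [NormedSpace ℝ W] (A : V →ₗ[ℝ] W) (hA : Function.Injective A)
    (hc : Continuous A) : Continuous (Projectivization.map A hA) :=
  (continuous_map_family (T := Unit) (fun _ => A) (fun _ => hA) (hc.comp continuous_snd)).comp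
    (continuous_const (y := ()) |>.prodMk continuous_id)

end Projectivization

/-! ### The simplex as a fundamental domain of the linear action on projective space -/

theorem stdSimplex_coe_ne_zero {n : ℕ} (x : stdSimplex ℝ (Fin (n + 1))) : x.1 ≠ 0 := by
  obtain ⟨i, hi⟩ := stdSimplex_exists_ne_zero x
  exact fun h => hi (by rw [h]; rfl)

/-- The point of `ℝP^n` whose homogeneous coordinates are the barycentric coordinates of a point of
the simplex. -/
noncomputable def simplexToRP {n : ℕ} (x : stdSimplex ℝ (Fin (n + 1))) : RP n :=
  Projectivization.mk ℝ x.1 (stdSimplex_coe_ne_zero x)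

theorem continuous_simplexToRP {n : ℕ} : Continuous (simplexToRP (n := n)) :=
  Projectivization.continuous_mk continuous_subtype_val _

theorem continuous_linearActionMap {n : ℕ} (g : TwoTorus n) : Continuous (linearActionMap g) :=
  Projectivization.continuous_map _ _ (LinearMap.continuous_of_finiteDimensional _)

/-- The coloring of the facets of the `n`-simplex that reconstructs `ℝP^n`: the facet `x_0 = 0` has
the color `e_1 + ⋯ + e_n`, and `x_i = 0` has the color `e_i`. -/
def simplexColor (n : ℕ) : Fin (n + 1) → TwoTorus n :=
  Fin.cons 1 fun j => Pi.single j 1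

theorem signUnit_one : signUnit 1 = -1 := by simp [signUnit]

theorem signUnit_zero : signUnit 0 = 1 := by simp [signUnit]

@[simp]
theorem signMap_apply_zero {n : ℕ} (g : TwoTorus n) (x : Fin (n + 1) → ℝ) :
    signMap g x 0 = x 0 := by
  simp [signMap, LinearEquiv.smulOfUnit]

@[simp]
theorem signMap_apply_succ {n : ℕ} (g : TwoTorus n) (x : Fin (n + 1) → ℝ) (j : Fin n) :
    signMap g x j.succ = (signUnit (g j) : ℝ) * x j.succ := by
  simp [signMap, LinearEquiv.smulOfUnit, Units.smul_def]

theorem abs_signUnit (a : ZMod 2) : |(signUnit a : ℝ)| = 1 := by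
  unfold signUnit; split_ifs <;> simp

theorem abs_signMap {n : ℕ} (g : TwoTorus n) (x : Fin (n + 1) → ℝ) (i : Fin (n + 1)) :
    |signMap g x i| = |x i| := by
  refine Fin.cases (by simp) (fun j => ?_) i
  rw [signMap_apply_succ, abs_mul, abs_signUnit, one_mul]

theorem ZMod.two_eq_zero_or_one (a : ZMod 2) : a = 0 ∨ a = 1 := by
  revert a; decide

/-- The color of the `k`-th facet acts on `ℝ^(n+1)` as the reflection that negates the `k`-th
coordinate, up to the global sign `-1` if `k = 0`. -/
theorem signMap_simplexColor {n : ℕ} (k : Fin (n + 1)) (x : Fin (n + 1) → ℝ) :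
    signMap (simplexColor n k) x =
      (if k = 0 then -1 else 1 : ℝ) • Function.update x k (-x k) := by
  funext i
  refine Fin.cases (Fin.cases ?_ (fun i => ?_) i) (fun k => Fin.cases ?_ (fun i => ?_) i) k
  · simp
  · simp [simplexColor, signUnit_one]
  · simp [Function.update_of_ne (Fin.succ_ne_zero k).symm]
  · by_cases h : i = k
    · subst h; simp [simplexColor, signUnit_one]
    · simp [simplexColor, h, signUnit_zero]

theorem update_neg_ne_zero {ι : Type} [DecidableEq ι] {x : ι → ℝ} (hx : x ≠ 0) (k : ι) :
    Function.update x k (-x k) ≠ 0 := by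
  obtain ⟨i, hi⟩ := Function.ne_iff.1 hx
  refine Function.ne_iff.2 ⟨i, ?_⟩
  by_cases h : i = k
  · subst h; simpa using hi
  · simpa [h] using hi

/-- The color of the `k`-th facet acts on `ℝP^n` by negating the `k`-th homogeneous coordinate. -/
theorem linearActionMap_simplexColor_mk {n : ℕ} (k : Fin (n + 1)) (x : Fin (n + 1) → ℝ)
    (hx : x ≠ 0) : linearActionMap (simplexColor n k) (Projectivization.mk ℝ x hx) =
      Projectivization.mk ℝ (Function.update x k (-x k)) (update_neg_ne_zero hx k) := by
  rw [linearActionMap, Projectivization.map_mk, Projectivization.mk_eq_mk_iff']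
  exact ⟨_, (signMap_simplexColor k x).symm⟩

theorem linearActionMap_simplexColor {n : ℕ} (x : stdSimplex ℝ (Fin (n + 1))) (k : Fin (n + 1))
    (hk : x.1 k = 0) : linearActionMap (simplexColor n k) (simplexToRP x) = simplexToRP x := by
  have h : Function.update x.1 k (-x.1 k) = x.1 := by
    rw [hk, neg_zero, ← hk, Function.update_eq_self]
  simp only [simplexToRP, linearActionMap_simplexColor_mk, h]

/-- The group element is recovered, up to the colors of the facets through `x`, from the signs of
the nonzero coordinates. -/
theorem mem_closure_simplexColor {n : ℕ} (x : Fin (n + 1) → ℝ) (g : TwoTorus n)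
    (h : ∀ j : Fin n, x j.succ ≠ 0 → g j = 0) :
    g ∈ AddSubgroup.closure {c | ∃ i, x i = 0 ∧ c = simplexColor n i} := by
  rw [← Finset.univ_sum_single g]
  refine AddSubgroup.sum_mem _ fun j _ => ?_
  by_cases hj : x j.succ = 0
  · rcases ZMod.two_eq_zero_or_one (g j) with h0 | h1
    · rw [h0, Pi.single_zero]; exact zero_mem _
    · rw [h1]; exact AddSubgroup.subset_closure ⟨j.succ, hj, rfl⟩
  · rw [h j hj, Pi.single_zero]; exact zero_mem _

theorem eq_of_linearActionMap_eq {n : ℕ} {g : TwoTorus n} {x y : stdSimplex ℝ (Fin (n + 1))}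
    (h : linearActionMap g (simplexToRP x) = simplexToRP y) :
    x = y ∧ g ∈ AddSubgroup.closure {c | ∃ i, x.1 i = 0 ∧ c = simplexColor n i} := by
  rw [simplexToRP, simplexToRP, linearActionMap, Projectivization.map_mk,
    Projectivization.mk_eq_mk_iff'] at h
  obtain ⟨a, ha⟩ := h
  have hi : ∀ i, a * y.1 i = signMap g x.1 i := fun i => congrFun ha i
  have habs : ∀ i, |a| * y.1 i = x.1 i := fun i => by
    rw [← abs_of_nonneg (y.2.1 i), ← abs_mul, hi, abs_signMap, abs_of_nonneg (x.2.1 i)]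
  have ha1 : |a| = 1 := by
    have : |a| * ∑ i, y.1 i = ∑ i, x.1 i := by rw [Finset.mul_sum]; simp [habs]
    rwa [y.2.2, x.2.2, mul_one] at this
  have hxy : x = y := Subtype.ext <| funext fun i => by rw [← habs i, ha1, one_mul]
  subst hxy
  refine ⟨rfl, ?_⟩
  have hsign : ∀ j : Fin n, x.1 j.succ ≠ 0 → (signUnit (g j) : ℝ) = a := fun j hj => by
    have := hi j.succ
    rw [signMap_apply_succ] at this
    exact (mul_right_cancel₀ hj this).symm
  have key : ∀ c : ZMod 2, (signUnit c : ℝ) = 1 → c = 0 := fun c hc => by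
    rcases ZMod.two_eq_zero_or_one c with rfl | rfl
    · rfl
    · norm_num [signUnit_one] at hc
  rcases eq_or_eq_neg_of_abs_eq ha1 with rfl | rfl
  · exact mem_closure_simplexColor _ _ fun j hj => key _ (hsign j hj)
  · -- the scalar `-1` forces `x_0 = 0`, and `g` differs by the color of that facet from an
    -- element with scalar `1`
    have h0 : x.1 0 = 0 := by
      have := hi 0
      rw [signMap_apply_zero] at this
      linarith
    have hg : g - 1 ∈ AddSubgroup.closure {c | ∃ i, x.1 i = 0 ∧ c = simplexColor n i} := by
      refine mem_closure_simplexColor _ _ fun j hj => key _ ?_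
      have := hsign j hj
      rcases ZMod.two_eq_zero_or_one (g j) with h | h
      · norm_num [h, signUnit_zero] at this
      · simp [h, signUnit_zero]
    have h1 : (1 : TwoTorus n) ∈
        AddSubgroup.closure {c | ∃ i, x.1 i = 0 ∧ c = simplexColor n i} :=
      AddSubgroup.subset_closure ⟨0, h0, rfl⟩
    simpa using add_mem hg h1

theorem exists_linearActionMap_eq {n : ℕ} (p : RP n) :
    ∃ (g : TwoTorus n) (x : stdSimplex ℝ (Fin (n + 1))),
      linearActionMap g (simplexToRP x) = p := by
  -- a representative with nonnegative first coordinate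
  obtain ⟨v, hv, h0, rfl⟩ : ∃ (v : Fin (n + 1) → ℝ) (hv : v ≠ 0), 0 ≤ v 0 ∧
      Projectivization.mk ℝ v hv = p := by
    induction p using Projectivization.ind with
    | h v hv =>
      rcases le_total 0 (v 0) with h | h
      · exact ⟨v, hv, h, rfl⟩
      · refine ⟨-v, neg_ne_zero.2 hv, by simpa using h, ?_⟩
        rw [Projectivization.mk_eq_mk_iff']
        exact ⟨-1, by simp⟩
  have hS : 0 < ∑ i, |v i| := by
    obtain ⟨i, hi⟩ := Function.ne_iff.1 hv
    exact Finset.sum_pos' (fun i _ => abs_nonneg _) ⟨i, Finset.mem_univ _, abs_pos.2 hi⟩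
  refine ⟨fun j => if 0 ≤ v j.succ then 0 else 1,
    ⟨fun i => |v i| / ∑ k, |v k|, fun i => by positivity, ?_⟩, ?_⟩
  · rw [← Finset.sum_div, div_self hS.ne']
  · rw [simplexToRP, linearActionMap, Projectivization.map_mk, Projectivization.mk_eq_mk_iff']
    refine ⟨(∑ k, |v k|)⁻¹, funext fun i => ?_⟩
    rw [Pi.smul_apply, smul_eq_mul, inv_mul_eq_div]
    refine Fin.cases ?_ (fun j => ?_) i
    · simp [abs_of_nonneg h0]
    · simp only [LinearEquiv.coe_coe, signMap_apply_succ]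
      split_ifs with hj
      · simp [signUnit_zero, abs_of_nonneg hj]
      · simp [signUnit_one, abs_of_neg (not_le.1 hj), neg_div]

theorem lambda0_color : lambda0.color = simplexColor 3 := by
  unfold lambda0 simplexColor
  decide +kernel

/-! ### The half circle as a fundamental domain of complex conjugation -/

open Real in
/-- The point `exp (i π x_0)` of the closed upper half circle. The end `x_0 = 0` is sent to `1` and
the end `x_1 = 0` to `-1`. -/
noncomputable def halfCircle (x : stdSimplex ℝ (Fin 2)) : Circle := Circle.exp (π * x.1 0)

open Real in
/-- The square root `exp (i π x_0 / 2)` of `halfCircle x`. -/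
noncomputable def quarterCircle (x : stdSimplex ℝ (Fin 2)) : Circle :=
  Circle.exp (π * x.1 0 / 2)

theorem quarterCircle_mul_self (x : stdSimplex ℝ (Fin 2)) :
    quarterCircle x * quarterCircle x = halfCircle x := by
  rw [quarterCircle, halfCircle, ← Circle.exp_add, add_halves]

theorem continuous_halfCircle : Continuous halfCircle :=
  Circle.exp.continuous.comp
    (continuous_const.mul ((continuous_apply 0).comp continuous_subtype_val))

theorem continuous_quarterCircle : Continuous quarterCircle :=
  Circle.exp.continuous.comp
    ((continuous_const.mul ((continuous_apply 0).comp continuous_subtype_val)).div_const 2)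

theorem arg_halfCircle (x : stdSimplex ℝ (Fin 2)) :
    Complex.arg (halfCircle x) = Real.pi * x.1 0 := by
  have h0 := x.2.1 0
  have h1 : x.1 0 ≤ 1 := (mem_Icc_of_mem_stdSimplex x.2 0).2
  exact Circle.arg_exp (by nlinarith [Real.pi_pos]) (by nlinarith [Real.pi_pos])

theorem halfCircle_injective : Function.Injective halfCircle := fun x y h => by
  have h2 := arg_halfCircle y
  rw [← h, arg_halfCircle x] at h2
  have h0 : x.1 0 = y.1 0 := mul_left_cancel₀ Real.pi_ne_zero h2
  have hx := x.2.2
  have hy := y.2.2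
  rw [Fin.sum_univ_two] at hx hy
  refine Subtype.ext <| funext fun i => ?_
  fin_cases i
  · exact h0
  · change x.1 1 = y.1 1
    linarith

theorem halfCircle_of_fst_eq_zero {x : stdSimplex ℝ (Fin 2)} (h : x.1 0 = 0) :
    halfCircle x = 1 := by simp [halfCircle, h]

theorem stdSimplex_fst_eq_one {x : stdSimplex ℝ (Fin 2)} (h : x.1 1 = 0) : x.1 0 = 1 := by
  have := x.2.2
  rw [Fin.sum_univ_two] at this
  linarith

theorem halfCircle_of_snd_eq_zero {x : stdSimplex ℝ (Fin 2)} (h : x.1 1 = 0) :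
    halfCircle x = -1 := by
  rw [halfCircle, stdSimplex_fst_eq_one h, mul_one]
  ext
  simp [Circle.coe_exp]

/-- Complex conjugation maps no interior point of the half circle into the half circle. -/
theorem eq_zero_of_halfCircle_inv_eq {x y : stdSimplex ℝ (Fin 2)}
    (h : (halfCircle x)⁻¹ = halfCircle y) : x.1 0 = 0 ∨ x.1 1 = 0 := by
  by_contra! hx
  have h0 := lt_of_le_of_ne (x.2.1 0) hx.1.symm
  have h1 := lt_of_le_of_ne (x.2.1 1) hx.2.symm
  have hs := x.2.2
  rw [Fin.sum_univ_two] at hs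
  have hy := arg_halfCircle y
  rw [← h, halfCircle, ← Circle.exp_neg,
    Circle.arg_exp (by nlinarith [Real.pi_pos]) (by nlinarith [Real.pi_pos])] at hy
  nlinarith [Real.pi_pos, y.2.1 0]

theorem exists_halfCircle_eq (z : Circle) : ∃ x, halfCircle x = z ∨ (halfCircle x)⁻¹ = z := by
  have hπ := Real.pi_pos
  have ht : |Complex.arg z| / Real.pi ≤ 1 :=
    (div_le_one hπ).2 (abs_le.2 ⟨(Complex.neg_pi_lt_arg _).le, Complex.arg_le_pi _⟩)
  refine ⟨⟨![|Complex.arg z| / Real.pi, 1 - |Complex.arg z| / Real.pi], ?_, ?_⟩, ?_⟩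
  · intro i
    fin_cases i
    · change 0 ≤ |Complex.arg z| / Real.pi
      positivity
    · change 0 ≤ 1 - |Complex.arg z| / Real.pi
      linarith
  · simp [Fin.sum_univ_two]
  · simp only [halfCircle, Matrix.cons_val_zero, mul_div_cancel₀ _ hπ.ne']
    rcases abs_choice (Complex.arg z) with h | h
    · left; rw [h, Circle.exp_arg]
    · right; rw [h, Circle.exp_neg, inv_inv, Circle.exp_arg]

/-! ### Small covers of the prism as projective plane bundles over the circle -/

theorem two_torus_eq_zero_or_simplexColor (g : TwoTorus 2) :
    g = 0 ∨ ∃ k, g = simplexColor 2 k := by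
  unfold simplexColor
  revert g
  decide +kernel

theorem prismColor_inr (c : TwoTorus 3) (k : Fin 3) :
    prismColor c (.inr k) = Fin.cons 0 (simplexColor 2 k) := by
  have : ∀ k : Fin 3, (![![0, 1, 1], ![0, 1, 0], ![0, 0, 1]] : Fin 3 → TwoTorus 3) k =
      Fin.cons 0 (simplexColor 2 k) := by
    unfold simplexColor
    decide +kernel
  exact this k

/-- The colors of the squares generate, at a point of the prism, the colors of the simplex facets
through its second component. -/
theorem cons_mem_isotropy {c : TwoTorus 3} {hc : c 0 = 1} (x : Prism3) {g : TwoTorus 2}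
    (hg : g ∈ AddSubgroup.closure {d | ∃ k, x.2.1 k = 0 ∧ d = simplexColor 2 k}) :
    (Fin.cons 0 g : TwoTorus 3) ∈ (prismColoring c hc).isotropy x := by
  induction hg using AddSubgroup.closure_induction with
  | mem d hd =>
    obtain ⟨k, hk, rfl⟩ := hd
    exact AddSubgroup.subset_closure ⟨.inr k, hk, (prismColor_inr c k).symm⟩
  | zero =>
    convert! zero_mem ((prismColoring c hc).isotropy x)
    decide
  | add a b _ _ ha hb =>
    convert! add_mem ha hb
    clear * -
    revert a b; decide +kernel
  | neg a _ ha =>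
    convert! neg_mem ha
    clear * -
    revert a; decide +kernel

theorem exists_eq_cons_of_apply_zero (g : TwoTorus 3) (h : g 0 = 0) :
    ∃ g' : TwoTorus 2, g = Fin.cons 0 g' :=
  ⟨Fin.tail g, by rw [← h, Fin.cons_self_tail]⟩

/-- A `(ℤ/2)^3`-action on a trivial bundle `S¹ × Y` is that of a small cover of the prism as soon as
`e_1` lies over complex conjugation; the colors of the squares act, in trivializations `j t` of the
fibers over the upper half circle, as the linear action on `ℝP²`; and the colors of the two
triangles act trivially on the fibers over the two ends `1` and `-1` of the half circle. The
fundamental domain is the set of the points `(halfCircle t, j t [y])` with `y` in the triangle. -/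
theorem equivariantlyHomeomorphic_prism {Y : Type} [TopologicalSpace Y] [T2Space Y]
    (c : TwoTorus 3) (hc : c 0 = 1) (b : TwoTorusAction 3 (Circle × Y))
    (hb : ∀ g, Continuous (b (Multiplicative.ofAdd g)))
    (j : stdSimplex ℝ (Fin 2) → RP 2 → Y) (hj : Continuous fun q : _ × RP 2 => j q.1 q.2)
    (hjb : ∀ t, Function.Bijective (j t))
    (hbase : ∀ z q, (b (Multiplicative.ofAdd ![1, 0, 0]) (z, q)).1 = z⁻¹)
    (hfiber : ∀ k t p,
      b (Multiplicative.ofAdd (Fin.cons 0 (simplexColor 2 k))) (halfCircle t, j t p) =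
        (halfCircle t, j t (linearActionMap (simplexColor 2 k) p)))
    (hend : ∀ q, b (Multiplicative.ofAdd ![1, 0, 0]) (1, q) = (1, q))
    (hend' : ∀ q, b (Multiplicative.ofAdd c) (-1, q) = (-1, q)) :
    EquivariantlyHomeomorphic (SmallCover.action (prismColoring c hc)) b := by
  have add_apply : ∀ g h p, b (Multiplicative.ofAdd (g + h)) p =
      b (Multiplicative.ofAdd g) (b (Multiplicative.ofAdd h) p) := fun g h p => by
    rw [ofAdd_add, map_mul, Equiv.Perm.mul_apply]
  have hfiber' : ∀ (g : TwoTorus 2) t p,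
      b (Multiplicative.ofAdd (Fin.cons 0 g)) (halfCircle t, j t p) =
        (halfCircle t, j t (linearActionMap g p)) := by
    intro g t p
    rcases two_torus_eq_zero_or_simplexColor g with rfl | ⟨k, rfl⟩
    · have : (Fin.cons 0 0 : TwoTorus 3) = 0 := by decide
      rw [this, ofAdd_zero, map_one, Equiv.Perm.one_apply, linearActionMap_zero]
    · exact hfiber k t p
  let s : Prism3 → Circle × Y := fun x => (halfCircle x.1, j x.1 (simplexToRP x.2))
  have hfix : ∀ i x, x ∈ prismFacet i →
      b (Multiplicative.ofAdd ((prismColoring c hc).color i)) (s x) = s x := by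
    rintro (i | k) x hx
    · fin_cases i
      · change b (Multiplicative.ofAdd ![1, 0, 0]) (halfCircle x.1, _) = (halfCircle x.1, _)
        rw [halfCircle_of_fst_eq_zero hx, hend]
      · change b (Multiplicative.ofAdd c) (halfCircle x.1, _) = (halfCircle x.1, _)
        rw [halfCircle_of_snd_eq_zero hx, hend']
    · change b (Multiplicative.ofAdd (prismColor c (.inr k))) (s x) = s x
      rw [prismColor_inr]
      simp only [s]
      rw [hfiber, linearActionMap_simplexColor x.2 k hx]
  -- elements over the identity of the circle
  have hinj₀ : ∀ g x y, g 0 = 0 → b (Multiplicative.ofAdd g) (s x) = s y →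
      x = y ∧ g ∈ (prismColoring c hc).isotropy x := by
    intro g x y hg h
    obtain ⟨g, rfl⟩ := exists_eq_cons_of_apply_zero g hg
    simp only [s] at h
    rw [hfiber', Prod.mk.injEq] at h
    obtain ⟨h1, h2⟩ := h
    have h1 := halfCircle_injective h1
    rw [← h1] at h2
    obtain ⟨h3, h4⟩ := eq_of_linearActionMap_eq ((hjb _).injective h2)
    exact ⟨Prod.ext h1 h3, cons_mem_isotropy x h4⟩
  refine equivariantlyHomeomorphic_of_fundamentalDomain _ b hb s ?_ hfix ?_ ?_
  · exact (continuous_halfCircle.comp continuous_fst).prodMk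
      (hj.comp (continuous_fst.prodMk (continuous_simplexToRP.comp continuous_snd)))
  · intro g x y h
    rcases ZMod.two_eq_zero_or_one (g 0) with hg | hg
    · exact hinj₀ g x y hg h
    · -- `g` lies over complex conjugation, so `x` is on a triangle; the color of that triangle
      -- brings `g` back to an element over the identity
      have hx : x.1.1 0 = 0 ∨ x.1.1 1 = 0 := by
        obtain ⟨g', hg'⟩ := exists_eq_cons_of_apply_zero (![1, 0, 0] + g) (by
          simp only [Pi.add_apply, hg]; decide)
        have e : g = ![1, 0, 0] + Fin.cons 0 g' := by
          rw [← hg', ← add_assoc]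
          have : (![1, 0, 0] + ![1, 0, 0] : TwoTorus 3) = 0 := by decide
          rw [this, zero_add]
        have h1 := congrArg Prod.fst h
        rw [e, add_apply] at h1
        simp only [s] at h1
        rw [hfiber', hbase] at h1
        exact eq_zero_of_halfCircle_inv_eq h1
      have reduce : ∀ i, x ∈ prismFacet i → (prismColoring c hc).color i 0 = 1 →
          x = y ∧ g ∈ (prismColoring c hc).isotropy x := by
        intro i hi hi1
        obtain ⟨hxy, hm⟩ := hinj₀ (g + (prismColoring c hc).color i) x y (by
          rw [Pi.add_apply, hg, hi1]; decide) (by rw [add_apply, hfix i x hi, h])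
        have hm' : (prismColoring c hc).color i ∈ (prismColoring c hc).isotropy x :=
          AddSubgroup.subset_closure ⟨i, hi, rfl⟩
        exact ⟨hxy, (add_mem_cancel_right hm').1 hm⟩
      rcases hx with hx | hx
      · exact reduce (.inl 0) hx rfl
      · exact reduce (.inl 1) hx hc
  · -- a point over the upper half circle, and then its conjugate
    have hup : ∀ t q, ∃ g x, b (Multiplicative.ofAdd g) (s x) = (halfCircle t, q) := by
      intro t q
      obtain ⟨p, rfl⟩ := (hjb t).surjective q
      obtain ⟨g, y, rfl⟩ := exists_linearActionMap_eq p
      exact ⟨Fin.cons 0 g, (t, y), hfiber' g t _⟩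
    rintro ⟨z, q⟩
    obtain ⟨t, rfl | rfl⟩ := exists_halfCircle_eq z
    · exact hup t q
    · obtain ⟨⟨z', q'⟩, hq'⟩ :=
        (b (Multiplicative.ofAdd ![1, 0, 0])).surjective ((halfCircle t)⁻¹, q)
      have h1 := hbase z' q'
      rw [hq', inv_inj] at h1
      obtain ⟨g, x, hgx⟩ := hup t q'
      refine ⟨![1, 0, 0] + g, x, ?_⟩
      rw [add_apply, hgx, ← hq']
      rw [h1]

/-! ### The rotating trivializations of the bundles with fiber `ℝP(ℂ ⊕ ℝ)` -/

theorem continuous_rot : Continuous fun q : Circle × RPCR => rot q.1 q.2 := by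
  refine Projectivization.continuous_map_family (fun u : Circle =>
    ((rotation u).toLinearEquiv.prodCongr (LinearEquiv.refl ℝ ℝ)).toLinearMap) _ ?_
  change Continuous fun q : Circle × ℂ × ℝ => ((q.1 : ℂ) * q.2.1, q.2.2)
  fun_prop

theorem continuous_conjRot : Continuous fun q : Circle × RPCR => conjRot q.1 q.2 := by
  refine Projectivization.continuous_map_family (fun u : Circle =>
    ((Complex.conjLIE.trans (rotation u)).toLinearEquiv.prodCongr
      (LinearEquiv.refl ℝ ℝ)).toLinearMap) _ ?_
  change Continuous fun q : Circle × ℂ × ℝ => ((q.1 : ℂ) * (starRingEnd ℂ) q.2.1, q.2.2)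
  have := Complex.continuous_conj
  fun_prop

/-- The identification of `ℝ³` with `ℂ ⊕ ℝ` that reads the real part, the imaginary part and the
last coordinate off the coordinates `π 0`, `π 1` and `π 2`. -/
noncomputable def coordEquiv (π : Equiv.Perm (Fin 3)) : (Fin 3 → ℝ) ≃ₗ[ℝ] ℂ × ℝ where
  toFun y := (⟨y (π 0), y (π 1)⟩, y (π 2))
  invFun v := fun i => ![v.1.re, v.1.im, v.2] (π.symm i)
  map_add' _ _ := rfl
  map_smul' a y := Prod.ext (Complex.ext (by simp) (by simp)) rfl
  left_inv y := by
    funext i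
    obtain ⟨i, rfl⟩ := π.surjective i
    fin_cases i <;> simp
  right_inv v := by ext <;> simp

/-- The identification of projective planes induced by `coordEquiv π`. -/
noncomputable def coordMap (π : Equiv.Perm (Fin 3)) : RP 2 → RPCR :=
  Projectivization.map (coordEquiv π).toLinearMap (coordEquiv π).injective

theorem coordMap_bijective (π : Equiv.Perm (Fin 3)) : Function.Bijective (coordMap π) := by
  refine ⟨Projectivization.map_injective _ _, fun p => ?_⟩
  induction p using Projectivization.ind with
  | h v hv =>
    refine ⟨Projectivization.mk ℝ ((coordEquiv π).symm v) (by simpa using hv), ?_⟩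
    simp [coordMap, Projectivization.map_mk]

theorem coordEquiv_apply_ne_zero (π : Equiv.Perm (Fin 3)) {x : Fin 3 → ℝ} (hx : x ≠ 0) :
    ((⟨x (π 0), x (π 1)⟩ : ℂ), x (π 2)) ≠ 0 :=
  (coordEquiv π).map_ne_zero_iff.2 hx

theorem coordMap_mk (π : Equiv.Perm (Fin 3)) (x : Fin 3 → ℝ) (hx : x ≠ 0) :
    coordMap π (Projectivization.mk ℝ x hx) =
      Projectivization.mk ℝ ((⟨x (π 0), x (π 1)⟩ : ℂ), x (π 2))
        (coordEquiv_apply_ne_zero π hx) := rfl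

theorem coordMap_re (π : Equiv.Perm (Fin 3)) (p : RP 2) :
    coordMap π (linearActionMap (simplexColor 2 (π 0)) p) = conjRot (-1) (coordMap π p) := by
  induction p using Projectivization.ind with
  | h x hx =>
    rw [linearActionMap_simplexColor_mk, coordMap_mk, coordMap_mk, conjRot_mk]
    congr 1
    exact Prod.ext (Complex.ext (by simp) (by simp)) (by simp)

theorem coordMap_im (π : Equiv.Perm (Fin 3)) (p : RP 2) :
    coordMap π (linearActionMap (simplexColor 2 (π 1)) p) = conjRot 1 (coordMap π p) := by
  induction p using Projectivization.ind with
  | h x hx =>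
    rw [linearActionMap_simplexColor_mk, coordMap_mk, coordMap_mk, conjRot_mk]
    congr 1
    exact Prod.ext (Complex.ext (by simp) (by simp)) (by simp)

theorem coordMap_last (π : Equiv.Perm (Fin 3)) (p : RP 2) :
    coordMap π (linearActionMap (simplexColor 2 (π 2)) p) = rot (-1) (coordMap π p) := by
  induction p using Projectivization.ind with
  | h x hx =>
    rw [linearActionMap_simplexColor_mk, coordMap_mk, coordMap_mk, rot_mk,
      Projectivization.mk_eq_mk_iff']
    -- the reflection in the last coordinate is the half turn of `ℂ`, up to a global sign
    exact ⟨-1, Prod.ext (Complex.ext (by simp) (by simp)) (by simp)⟩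

theorem rot_bijective (u : Circle) : Function.Bijective (rot u) :=
  Function.bijective_iff_has_inverse.2
    ⟨rot u⁻¹, fun p => by simp [rot_rot, rot_one], fun p => by simp [rot_rot, rot_one]⟩

theorem Continuous.rot {T : Type} [TopologicalSpace T] {u : T → Circle} {q : T → RPCR}
    (hu : Continuous u) (hq : Continuous q) : Continuous fun t => _root_.rot (u t) (q t) := by
  have h := continuous_rot.comp (hu.prodMk hq)
  simpa only [Function.comp_def] using h

theorem Continuous.conjRot {T : Type} [TopologicalSpace T] {u : T → Circle} {q : T → RPCR}
    (hu : Continuous u) (hq : Continuous q) : Continuous fun t => _root_.conjRot (u t) (q t) := by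
  have h := continuous_conjRot.comp (hu.prodMk hq)
  simpa only [Function.comp_def] using h

theorem continuous_coordMap (π : Equiv.Perm (Fin 3)) : Continuous (coordMap π) :=
  Projectivization.continuous_map _ _ (LinearMap.continuous_of_finiteDimensional _)

/-- The instance of `equivariantlyHomeomorphic_prism` in which the trivialization `j t` of the fiber
over `halfCircle t` is an identification of `ℝP²` with `ℝP(ℂ ⊕ ℝ)` followed by the rotation
`[v, w] ↦ [u t · v, w]`. -/
theorem equivariantlyHomeomorphic_prism_rot (c : TwoTorus 3) (hc : c 0 = 1)
    (b : TwoTorusAction 3 (Circle × RPCR)) (hb : ∀ g, Continuous (b (Multiplicative.ofAdd g)))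
    (u : stdSimplex ℝ (Fin 2) → Circle) (hu : Continuous u) (π : Equiv.Perm (Fin 3))
    (hbase : ∀ z q, (b (Multiplicative.ofAdd ![1, 0, 0]) (z, q)).1 = z⁻¹)
    (hre : ∀ t q, b (Multiplicative.ofAdd (Fin.cons 0 (simplexColor 2 (π 0))))
      (halfCircle t, rot (u t) q) = (halfCircle t, rot (u t) (conjRot (-1) q)))
    (him : ∀ t q, b (Multiplicative.ofAdd (Fin.cons 0 (simplexColor 2 (π 1))))
      (halfCircle t, rot (u t) q) = (halfCircle t, rot (u t) (conjRot 1 q)))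
    (hlast : ∀ t q, b (Multiplicative.ofAdd (Fin.cons 0 (simplexColor 2 (π 2))))
      (halfCircle t, rot (u t) q) = (halfCircle t, rot (u t) (rot (-1) q)))
    (hend : ∀ q, b (Multiplicative.ofAdd ![1, 0, 0]) (1, q) = (1, q))
    (hend' : ∀ q, b (Multiplicative.ofAdd c) (-1, q) = (-1, q)) :
    EquivariantlyHomeomorphic (SmallCover.action (prismColoring c hc)) b := by
  refine equivariantlyHomeomorphic_prism c hc b hb (fun t p => rot (u t) (coordMap π p)) ?_
    (fun t => (rot_bijective _).comp (coordMap_bijective π)) hbase ?_ hend hend'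
  · exact (hu.comp continuous_fst).rot ((continuous_coordMap π).comp continuous_snd)
  · intro k t p
    obtain ⟨k, rfl⟩ := π.surjective k
    fin_cases k
    · exact (hre t _).trans (by rw [← coordMap_re]; rfl)
    · exact (him t _).trans (by rw [← coordMap_im]; rfl)
    · exact (hlast t _).trans (by rw [← coordMap_last]; rfl)

theorem continuous_actionOfInvolutions {X : Type} [TopologicalSpace X] {t₁ t₂ t₃ : X → X}
    {h₁ : Function.Involutive t₁} {h₂ : Function.Involutive t₂} {h₃ : Function.Involutive t₃}
    {h₁₂ : Function.Commute t₁ t₂} {h₁₃ : Function.Commute t₁ t₃} {h₂₃ : Function.Commute t₂ t₃}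
    (c₁ : Continuous t₁) (c₂ : Continuous t₂) (c₃ : Continuous t₃) (g : TwoTorus 3) :
    Continuous (actionOfInvolutions t₁ t₂ t₃ h₁ h₂ h₃ h₁₂ h₁₃ h₂₃ (Multiplicative.ofAdd g)) :=
  (c₁.iterate _).comp ((c₂.iterate _).comp (c₃.iterate _))

theorem continuous_phi1 (g : TwoTorus 3) : Continuous (phi1 (Multiplicative.ofAdd g)) := by
  have : Continuous (circleConj (g 0)) := by
    unfold circleConj; split_ifs
    · exact continuous_id
    · exact continuous_inv
  exact (this.comp continuous_fst).prodMk
    ((continuous_linearActionMap ![g 1, g 2]).comp continuous_snd)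

/-! ### The five equivariant homeomorphisms -/

theorem lambda0_equivariantlyHomeomorphic :
    EquivariantlyHomeomorphic (SmallCover.action lambda0) (linearAction 3) := by
  refine equivariantlyHomeomorphic_of_fundamentalDomain lambda0 (linearAction 3)
    continuous_linearActionMap simplexToRP continuous_simplexToRP ?_ ?_ exists_linearActionMap_eq
  · intro i x hx
    rw [lambda0_color]
    exact linearActionMap_simplexColor x i hx
  · intro g x y h
    rw [Coloring.isotropy, lambda0_color]
    exact eq_of_linearActionMap_eq h

theorem phi1_apply (g : TwoTorus 3) (p : Circle × RP 2) :
    phi1 (Multiplicative.ofAdd g) p = (circleConj (g 0) p.1, linearActionMap ![g 1, g 2] p.2) :=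
  rfl

theorem lambda1_equivariantlyHomeomorphic :
    EquivariantlyHomeomorphic (SmallCover.action lambda1) phi1 := by
  have end_apply : ∀ z : Circle, ∀ q,
      phi1 (Multiplicative.ofAdd ![1, 0, 0]) (z, q) = (z⁻¹, q) := by
    intro z q
    have h0 : (![(![1, 0, 0] : TwoTorus 3) 1, (![1, 0, 0] : TwoTorus 3) 2] : TwoTorus 2) = 0 := by
      decide
    rw [phi1_apply, h0, linearActionMap_zero]
    rfl
  refine equivariantlyHomeomorphic_prism ![1, 0, 0] rfl phi1 continuous_phi1 (fun _ p => p)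
    continuous_snd (fun _ => Function.bijective_id) (fun z q => by rw [end_apply]) ?_
    (fun q => by rw [end_apply, inv_one]) (fun q => by rw [end_apply]; simp)
  intro k t p
  have hk : ∀ a : TwoTorus 2, (![(Fin.cons 0 a : TwoTorus 3) 1, (Fin.cons 0 a : TwoTorus 3) 2] :
      TwoTorus 2) = a := by decide +kernel
  rw [phi1_apply, hk]
  rfl

theorem continuous_phi2 (g : TwoTorus 3) : Continuous (phi2 (Multiplicative.ofAdd g)) :=
  continuous_actionOfInvolutions
    (continuous_fst.inv.prodMk (continuous_fst.rot continuous_snd))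
    (continuous_fst.prodMk (continuous_fst.inv.neg.conjRot continuous_snd))
    (continuous_fst.inv.prodMk (continuous_fst.neg.rot continuous_snd)) g

theorem continuous_phi3 (g : TwoTorus 3) : Continuous (phi3 (Multiplicative.ofAdd g)) :=
  continuous_actionOfInvolutions
    (continuous_fst.inv.prodMk (continuous_fst.rot continuous_snd))
    (continuous_fst.prodMk (continuous_fst.inv.conjRot continuous_snd))
    (continuous_fst.inv.prodMk (continuous_fst.neg.rot continuous_snd)) g

theorem continuous_phi4 (g : TwoTorus 3) : Continuous (phi4 (Multiplicative.ofAdd g)) :=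
  continuous_actionOfInvolutions
    (continuous_fst.inv.prodMk (continuous_fst.inv.rot continuous_snd))
    (continuous_fst.prodMk (continuous_fst.conjRot continuous_snd))
    (continuous_fst.prodMk (continuous_fst.neg.conjRot continuous_snd)) g

/-- In the coordinates `z = u²` and `v = u⁻¹ (y_2 + i y_0)`, `w = y_1`, where `u` is `quarterCircle t`,
the involution `t₁` fixes the fiber over `z = 1` and `t₃` the one over `z = -1`. The reflections in
the coordinates `y_0`, `y_1`, `y_2` are `t₁ t₂ t₃`, `t₁ t₃` and `t₂`, and these are the elements
that `σ₂` assigns to the colors of the squares. -/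
theorem lambda2_twistedEquivariantlyHomeomorphic :
    TwistedEquivariantlyHomeomorphic sigma2 (SmallCover.action lambda2) phi2 := by
  refine EquivariantlyHomeomorphic.twisted (equivariantlyHomeomorphic_prism_rot ![1, 1, 0] rfl _
    (fun g => continuous_phi2 (sigma2 g)) (fun t => (quarterCircle t)⁻¹)
    continuous_quarterCircle.inv (finRotate 3).symm ?_ ?_ ?_ ?_ ?_ ?_)
  · intro z q
    rfl
  · intro t q
    change (halfCircle t, conjRot (-(halfCircle t)⁻¹) (rot (quarterCircle t)⁻¹ q)) = _
    rw [conjRot_rot, rot_conjRot, ← quarterCircle_mul_self]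
    simp
  · intro t q
    change ((halfCircle t)⁻¹⁻¹, rot (halfCircle t)⁻¹ (conjRot (-(halfCircle t)⁻¹⁻¹)
      (rot (-halfCircle t) (rot (quarterCircle t)⁻¹ q)))) = _
    simp [rot_rot, conjRot_rot, rot_conjRot, ← quarterCircle_mul_self]
  · intro t q
    change ((halfCircle t)⁻¹⁻¹, rot (halfCircle t)⁻¹ (rot (-halfCircle t)
      (rot (quarterCircle t)⁻¹ q))) = _
    simp [rot_rot, ← quarterCircle_mul_self]
  · intro q
    change ((1 : Circle)⁻¹, rot 1 q) = _
    simp [rot_one]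
  · intro q
    change ((-1 : Circle)⁻¹, rot (- -1) q) = _
    simp [rot_one]

/-- The trivialization differs from the one for `φ₂` only in the order of the coordinates: here
`v = u⁻¹ (y_0 + i y_1)` and `w = y_2`, and the reflections in `y_0`, `y_1`, `y_2` are
`t₁ t₂ t₃`, `t₂` and `t₁ t₃`. -/
theorem lambda3_twistedEquivariantlyHomeomorphic :
    TwistedEquivariantlyHomeomorphic sigma3 (SmallCover.action lambda3) phi3 := by
  refine EquivariantlyHomeomorphic.twisted (equivariantlyHomeomorphic_prism_rot ![1, 0, 1] rfl _
    (fun g => continuous_phi3 (sigma3 g)) (fun t => (quarterCircle t)⁻¹)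
    continuous_quarterCircle.inv 1 ?_ ?_ ?_ ?_ ?_ ?_)
  · intro z q
    rfl
  · intro t q
    change ((halfCircle t)⁻¹⁻¹, rot (halfCircle t)⁻¹ (conjRot (halfCircle t)⁻¹⁻¹
      (rot (-halfCircle t) (rot (quarterCircle t)⁻¹ q)))) = _
    simp [rot_rot, conjRot_rot, rot_conjRot, ← quarterCircle_mul_self]
  · intro t q
    change (halfCircle t, conjRot (halfCircle t)⁻¹ (rot (quarterCircle t)⁻¹ q)) = _
    simp [conjRot_rot, rot_conjRot, ← quarterCircle_mul_self]
  · intro t q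
    change ((halfCircle t)⁻¹⁻¹, rot (halfCircle t)⁻¹ (rot (-halfCircle t)
      (rot (quarterCircle t)⁻¹ q))) = _
    simp [rot_rot, ← quarterCircle_mul_self]
  · intro q
    change ((1 : Circle)⁻¹, rot 1 q) = _
    simp [rot_one]
  · intro q
    change ((-1 : Circle)⁻¹, rot (- -1) q) = _
    simp [rot_one]

/-- Here the fibers rotate the other way, `v = u (y_2 + i y_1)` and `w = y_0`: the reflections in
`y_0`, `y_1`, `y_2` are `t₂ t₃`, `t₂` and `t₃`, and over `z = -1` it is `t₁ t₂ t₃` that acts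
trivially. -/
theorem lambda4_equivariantlyHomeomorphic :
    EquivariantlyHomeomorphic (SmallCover.action lambda4) phi4 := by
  refine equivariantlyHomeomorphic_prism_rot ![1, 1, 1] rfl phi4 continuous_phi4 quarterCircle
    continuous_quarterCircle (Equiv.swap 0 2) ?_ ?_ ?_ ?_ ?_ ?_
  · intro z q
    rfl
  · intro t q
    change (halfCircle t, conjRot (-halfCircle t) (rot (quarterCircle t) q)) = _
    simp [conjRot_rot, rot_conjRot, ← quarterCircle_mul_self]
  · intro t q
    change (halfCircle t, conjRot (halfCircle t) (rot (quarterCircle t) q)) = _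
    simp [conjRot_rot, rot_conjRot, ← quarterCircle_mul_self]
  · intro t q
    change (halfCircle t, conjRot (halfCircle t) (conjRot (-halfCircle t)
      (rot (quarterCircle t) q))) = _
    simp [rot_rot, conjRot_conjRot, ← quarterCircle_mul_self]
  · intro q
    change ((1 : Circle)⁻¹, rot 1⁻¹ q) = _
    simp [rot_one]
  · intro q
    change ((-1 : Circle)⁻¹, rot (-1)⁻¹ (conjRot (-1) (conjRot (- -1) q))) = _
    simp [conjRot_conjRot, rot_rot, rot_one]

theorem mainTheorem5 :
    EquivariantlyHomeomorphic (SmallCover.action lambda0) (linearAction 3) ∧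
    EquivariantlyHomeomorphic (SmallCover.action lambda1) phi1 ∧
    (TwistedEquivariantlyHomeomorphic sigma2 (SmallCover.action lambda2) phi2 ∧
      EquivariantlyHomeomorphic (SmallCover.action (lambda2.comp sigma2)) phi2) ∧
    (TwistedEquivariantlyHomeomorphic sigma3 (SmallCover.action lambda3) phi3 ∧
      EquivariantlyHomeomorphic (SmallCover.action (lambda3.comp sigma3)) phi3) ∧
    EquivariantlyHomeomorphic (SmallCover.action lambda4) phi4 :=
  ⟨lambda0_equivariantlyHomeomorphic, lambda1_equivariantlyHomeomorphic,
    ⟨lambda2_twistedEquivariantlyHomeomorphic,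
      lambda2_twistedEquivariantlyHomeomorphic.comp⟩,
    ⟨lambda3_twistedEquivariantlyHomeomorphic,
      lambda3_twistedEquivariantlyHomeomorphic.comp⟩,
    lambda4_equivariantlyHomeomorphic⟩
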